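/- Let $\mathbb{K}$ be an algebraically closed field of characteristic $0$ and let $n,s\ge 0$ be integers. Let $\mathrm{ad}\,\mathbb{K}^n$ be the vector space of $n\times n$ matrices of trace zero, $\mathbb{P}(\mathrm{ad}\,\mathbb{K}^n)$ the projective space of lines in it, with $\mathcal{O}(1)$ the line bundle whose fiber at a line $\ell$ is $\ell^*$, and $Gr(s,\mathbb{K}^n)$ the Grassmannian of $s$-dimensional subspaces of $\mathbb{K}^n$, with tangent bundle $TGr(s,\mathbb{K}^n)=\mathrm{Hom}(S,Q)$, where $S$ and $Q$ are the universal subbundle and quotient bundle; its fiber at $V$ is $\mathrm{Hom}(V,\mathbb{K}^n/V)$. Let $p,q$ be the projections of $X=\mathbb{P}(\mathrm{ad}\,\mathbb{K}^n)\times Gr(s,\mathbb{K}^n)$ to its two factors and put $$E=p^*\mathcal{O}(1)\otimes q^*TGr(s,\mathbb{K}^n).$$ Restricting a linear form to lines gives a natural map $(\mathrm{ad}\,\mathbb{K}^n)^*\to H^0(\mathcal{O}(1))$, and sending $A$ to the section $s_A$ whose value at $V$ is the composition $V\hookrightarrow\mathbb{K}^n\xrightarrow{A}\mathbb{K}^n\to\mathbb{K}^n/V$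 gives a natural map $\mathrm{ad}\,\mathbb{K}^n\to H^0(TGr(s,\mathbb{K}^n))$. Let $c\in H^0(X,E)$ be the canonical section, the image of the identity map of $\mathrm{ad}\,\mathbb{K}^n$ under $$\mathrm{End}(\mathrm{ad}\,\mathbb{K}^n)\cong(\mathrm{ad}\,\mathbb{K}^n)^*\otimes\mathrm{ad}\,\mathbb{K}^n\to H^0(\mathcal{O}(1))\otimes H^0(TGr(s,\mathbb{K}^n))\to H^0(X,E),$$ where the last map is $\sigma\otimes\tau\mapsto p^*\sigma\otimes q^*\tau$. Then the zero locus of $c$ (the set of points of $X$ at which $c$ vanishes) equals the incidence variety: $$Z(c)=\mathcal{J}:=\{(A,V)\in\mathbb{P}(\mathrm{ad}\,\mathbb{K}^n)\times Gr(s,\mathbb{K}^n)\mid A(V)\subseteq V\}.$$ -/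

import Mathlib

open scoped LinearAlgebra.Projectivization TensorProduct

noncomputable section

namespace KalmanVariety

/-! ### Polynomial maps between finite-dimensional vector spaces -/

section Polynomial

variable (K : Type*) [Field K]

/-- The regular functions on the affine space underlying a finite-dimensional vector space `M`:
the algebra of functions `M → K` generated by the linear functionals (the coordinates). -/
def polyFun (M : Type*) [AddCommGroup M] [Module K M] : Subalgebra K (M → K) :=
  Algebra.adjoin K (Set.range fun φ : Module.Dual K M => (fun m => φ m : M → K))

variable {M N N₁ N₂ : Type*} [AddCommGroup M] [Module K M] [AddCommGroup N] [Module K N]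
  [AddCommGroup N₁] [Module K N₁] [AddCommGroup N₂] [Module K N₂]

/-- A map between finite-dimensional vector spaces all of whose coordinates are polynomial
functions, i.e. a morphism of the underlying affine spaces. -/
def IsPolyMap (g : M → N) : Prop :=
  ∀ ψ : Module.Dual K N, (fun m => ψ (g m)) ∈ polyFun K M

variable {K}

theorem IsPolyMap.const (c : N) : IsPolyMap K (fun _ : M => c) :=
  fun ψ => (polyFun K M).algebraMap_mem (ψ c)

theorem IsPolyMap.linear (g : M →ₗ[K] N) : IsPolyMap K (fun m => g m) :=
  fun ψ => Algebra.subset_adjoin ⟨ψ ∘ₗ g, rfl⟩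

theorem IsPolyMap.add {g h : M → N} (hg : IsPolyMap K g) (hh : IsPolyMap K h) :
    IsPolyMap K (fun m => g m + h m) := fun ψ => by
  simp only [map_add]
  exact (polyFun K M).add_mem (hg ψ) (hh ψ)

theorem IsPolyMap.sub {g h : M → N} (hg : IsPolyMap K g) (hh : IsPolyMap K h) :
    IsPolyMap K (fun m => g m - h m) := fun ψ => by
  simp only [map_sub]
  exact (polyFun K M).sub_mem (hg ψ) (hh ψ)

theorem IsPolyMap.smul (a : K) {g : M → N} (hg : IsPolyMap K g) :
    IsPolyMap K (fun m => a • g m) := fun ψ => by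
  simp only [map_smul]
  exact (polyFun K M).smul_mem (hg ψ) a

theorem IsPolyMap.bilin [FiniteDimensional K N₁] (B : N₁ →ₗ[K] N₂ →ₗ[K] N)
    {g : M → N₁} {h : M → N₂} (hg : IsPolyMap K g) (hh : IsPolyMap K h) :
    IsPolyMap K (fun m => B (g m) (h m)) := fun ψ => by
  have hb : ∀ m, ψ (B (g m) (h m)) = ∑ i, (Module.finBasis K N₁).coord i (g m) *
      (ψ ∘ₗ B (Module.finBasis K N₁ i)) (h m) := fun m => by
    conv_lhs => rw [← (Module.finBasis K N₁).sum_repr (g m)]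
    simp only [map_sum, LinearMap.sum_apply, map_smul, LinearMap.smul_apply, smul_eq_mul,
      Module.Basis.coord_apply, LinearMap.comp_apply]
  have he : (fun m => ψ (B (g m) (h m))) =
      ∑ i, (fun m => (Module.finBasis K N₁).coord i (g m)) *
        (fun m => (ψ ∘ₗ B (Module.finBasis K N₁ i)) (h m)) := by
    funext m
    simp only [hb, Finset.sum_apply, Pi.mul_apply]
  rw [he]
  exact (polyFun K M).sum_mem fun i _ => (polyFun K M).mul_mem (hg _) (hh _)

theorem IsPolyMap.fun_smul {u : M → K} {g : M → N} (hu : IsPolyMap K u) (hg : IsPolyMap K g) :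
    IsPolyMap K (fun m => u m • g m) :=
  IsPolyMap.bilin (LinearMap.lsmul K N) hu hg

theorem IsPolyMap.comp [FiniteDimensional K N₁] [FiniteDimensional K N₂]
    {g : M → (N₁ →ₗ[K] N₂)} {h : M → (N →ₗ[K] N₁)} (hg : IsPolyMap K g) (hh : IsPolyMap K h) :
    IsPolyMap K (fun m => g m ∘ₗ h m) :=
  IsPolyMap.bilin (LinearMap.llcomp K N N₁ N₂) hg hh

theorem IsPolyMap.comp_linear {g : M → N} (hg : IsPolyMap K g) (l : N₁ →ₗ[K] M) :
    IsPolyMap K (fun x => g (l x)) := fun ψ => by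
  let F : (M → K) →ₐ[K] (N₁ → K) :=
    { toFun := fun u x => u (l x), map_one' := rfl, map_mul' := fun _ _ => rfl, map_zero' := rfl,
      map_add' := fun _ _ => rfl, commutes' := fun _ => rfl }
  have hle : polyFun K M ≤ (polyFun K N₁).comap F := by
    refine Algebra.adjoin_le ?_
    rintro _ ⟨φ, rfl⟩
    exact Algebra.subset_adjoin ⟨φ ∘ₗ l, rfl⟩
  exact hle (hg ψ)

theorem IsPolyMap.comp_fst {g : M → N} (hg : IsPolyMap K g) :
    IsPolyMap K (fun y : M × N₁ => g y.1) :=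
  hg.comp_linear (LinearMap.fst K M N₁)

theorem IsPolyMap.comp_snd {g : M → N} (hg : IsPolyMap K g) :
    IsPolyMap K (fun y : N₁ × M => g y.2) :=
  hg.comp_linear (LinearMap.snd K N₁ M)

end Polynomial

/-! ### The line bundle `𝒪(1)` on the projective space of lines in `M` -/

section ProjectiveSpace

variable (K : Type*) [Field K] (M : Type*) [AddCommGroup M] [Module K M]

/-- The fiber of `𝒪(1)` at a line `ℓ ⊆ M` is the dual `ℓ*`. -/
abbrev O1Fiber (ℓ : ℙ K M) : Type _ := Module.Dual K ℓ.submodule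

/-- An affine chart of `ℙ(M)`: for a vector `a ≠ 0` and a complement `H` of the line `K a`,
the affine space `H` is embedded in `ℙ(M)` as an open subset by `h ↦ [a + h]`. -/
structure ProjChart where
  a : M
  a_ne : a ≠ 0
  H : Submodule K M
  isCompl : IsCompl (K ∙ a) H

variable {K M}

theorem ProjChart.add_ne_zero (C : ProjChart K M) (h : C.H) : C.a + (h : M) ≠ 0 := by
  intro h0
  have h1 : C.a ∈ C.H := by
    rw [eq_neg_of_add_eq_zero_left h0]
    exact C.H.neg_mem h.2
  exact C.a_ne (Submodule.disjoint_def.1 C.isCompl.disjoint _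
    (Submodule.mem_span_singleton_self _) h1)

/-- The point `[a + h]` of `ℙ(M)`. -/
def ProjChart.point (C : ProjChart K M) (h : C.H) : ℙ K M :=
  Projectivization.mk K (C.a + (h : M)) (C.add_ne_zero h)

/-- The generator `a + h` of the line `[a + h]`. -/
def ProjChart.gen (C : ProjChart K M) (h : C.H) : (C.point h).submodule :=
  ⟨C.a + (h : M), by
    rw [ProjChart.point, Projectivization.submodule_mk]
    exact Submodule.mem_span_singleton_self _⟩

/-- The trivialization of `𝒪(1)` over a chart: evaluation of `φ ∈ [a + h]*` at `a + h`. -/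
def ProjChart.triv (C : ProjChart K M) (h : C.H) : O1Fiber K M (C.point h) →ₗ[K] K :=
  Module.Dual.eval K (C.point h).submodule (C.gen h)

variable (K M)

/-- `H⁰(ℙ(M), 𝒪(1))`: the global sections of `𝒪(1)` that are regular in every chart.
The charts cover, and regular functions on the affine space `H` are the polynomial ones. -/
def H0O1 : Submodule K ((ℓ : ℙ K M) → O1Fiber K M ℓ) where
  carrier := {σ | ∀ C : ProjChart K M, IsPolyMap K fun h : C.H => C.triv h (σ (C.point h))}
  zero_mem' := fun C => by simpa using IsPolyMap.const (K := K) (M := C.H) (0 : K)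
  add_mem' := fun hσ hτ C => by simpa using (hσ C).add (hτ C)
  smul_mem' := fun a _ hσ C => by simpa using (hσ C).smul a

/-- The natural map `M* → H⁰(ℙ(M), 𝒪(1))`, restricting a linear form to each line. -/
def dualToH0O1 : Module.Dual K M →ₗ[K] H0O1 K M where
  toFun φ := ⟨fun ℓ => φ ∘ₗ ℓ.submodule.subtype, fun C => by
    have : (fun h : C.H => C.triv h (φ ∘ₗ (C.point h).submodule.subtype)) =
        fun h : C.H => φ C.a + (φ ∘ₗ C.H.subtype) h := by
      funext h
      simp [ProjChart.triv, ProjChart.gen]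
    rw [this]
    exact (IsPolyMap.const _).add (IsPolyMap.linear _)⟩
  map_add' _ _ := rfl
  map_smul' _ _ := rfl

end ProjectiveSpace

/-! ### The tangent bundle `TGr(s, Kⁿ) = Hom(S, Q)` of the Grassmannian -/

section Grassmannian

variable (K : Type*) [Field K] (n s : ℕ)

/-- The Grassmannian `Gr(s, Kⁿ)` of `s`-dimensional subspaces of `Kⁿ`. -/
abbrev Gr : Type _ := {V : Submodule K (Fin n → K) // Module.finrank K V = s}

/-- The fiber `Hom(V, Kⁿ/V)` of the tangent bundle `TGr(s, Kⁿ) = Hom(S, Q)` at `V`; here `S` is the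
universal subbundle, with fiber `V`, and `Q` the universal quotient bundle, with fiber `Kⁿ/V`. -/
abbrev TGrFiber (V : Gr K n s) : Type _ := V.1 →ₗ[K] ((Fin n → K) ⧸ V.1)

/-- An affine chart of the Grassmannian: for `V₀ ∈ Gr(s, Kⁿ)` and a complement `W` of `V₀`, the
affine space `Hom(V₀, W)` is embedded in `Gr(s, Kⁿ)`, as the open set of all complements of `W`,
by sending `f` to its graph `{v + f v | v ∈ V₀}`. -/
structure GrChart where
  V₀ : Gr K n s
  W : Submodule K (Fin n → K)
  isCompl : IsCompl V₀.1 W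

variable {K n s}

/-- The affine space `Hom(V₀, W)` of a chart. -/
abbrev GrChart.Coord (C : GrChart K n s) : Type _ := C.V₀.1 →ₗ[K] C.W

/-- The map `V₀ → Kⁿ`, `v ↦ v + f v`. -/
def GrChart.emb (C : GrChart K n s) (f : C.Coord) : C.V₀.1 →ₗ[K] (Fin n → K) :=
  C.V₀.1.subtype + C.W.subtype ∘ₗ f

theorem GrChart.emb_apply (C : GrChart K n s) (f : C.Coord) (v : C.V₀.1) :
    C.emb f v = (v : Fin n → K) + (f v : Fin n → K) := rfl

theorem GrChart.emb_injective (C : GrChart K n s) (f : C.Coord) :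
    Function.Injective (C.emb f) := by
  rw [← LinearMap.ker_eq_bot, LinearMap.ker_eq_bot']
  intro v hv
  rw [GrChart.emb_apply] at hv
  have h1 : (v : Fin n → K) ∈ C.W := by
    rw [eq_neg_of_add_eq_zero_left hv]
    exact C.W.neg_mem (f v).2
  exact Subtype.ext (Submodule.disjoint_def.1 C.isCompl.disjoint _ v.2 h1)

/-- The graph of `f`, as a point of the Grassmannian. -/
def GrChart.point (C : GrChart K n s) (f : C.Coord) : Gr K n s :=
  ⟨LinearMap.range (C.emb f), by
    rw [LinearMap.finrank_range_of_inj (C.emb_injective f)]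
    exact C.V₀.2⟩

theorem GrChart.isCompl_point (C : GrChart K n s) (f : C.Coord) :
    IsCompl (C.point f).1 C.W := by
  constructor
  · rw [Submodule.disjoint_def]
    rintro _ ⟨v, rfl⟩ hv
    rw [GrChart.emb_apply] at hv ⊢
    have h1 : (v : Fin n → K) ∈ C.W := by
      simpa using C.W.sub_mem hv (f v).2
    have h2 : v = 0 := Subtype.ext (Submodule.disjoint_def.1 C.isCompl.disjoint _ v.2 h1)
    simp [h2]
  · rw [codisjoint_iff, eq_top_iff]
    intro x _
    obtain ⟨v, hv, w, hw, rfl⟩ := Submodule.mem_sup.1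
      (show x ∈ C.V₀.1 ⊔ C.W by rw [C.isCompl.sup_eq_top]; trivial)
    refine Submodule.mem_sup.2 ⟨C.emb f ⟨v, hv⟩, ⟨⟨v, hv⟩, rfl⟩, w - f ⟨v, hv⟩,
      C.W.sub_mem hw (f ⟨v, hv⟩).2, ?_⟩
    rw [GrChart.emb_apply]
    abel

/-- The trivialization of `Hom(S, Q)` over a chart: at the graph `V` of `f` it is the isomorphism
`Hom(V, Kⁿ/V) ≅ Hom(V₀, W)` induced by `V₀ ≅ V`, `v ↦ v + f v`, and `W ≅ Kⁿ/V`. This is the usual identification of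
`Hom(V, Kⁿ/V)` with the tangent space of the affine chart `Hom(V₀, W)` at `f`. -/
def GrChart.triv (C : GrChart K n s) (f : C.Coord) :
    TGrFiber K n s (C.point f) ≃ₗ[K] C.Coord :=
  LinearEquiv.arrowCongr (LinearEquiv.ofInjective (C.emb f) (C.emb_injective f)).symm
    (Submodule.quotientEquivOfIsCompl (C.point f).1 C.W (C.isCompl_point f))

variable (K n s)

/-- `H⁰(TGr(s, Kⁿ))`: the global sections of `Hom(S, Q)` that are regular in every chart. -/
def H0TGr : Submodule K ((V : Gr K n s) → TGrFiber K n s V) where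
  carrier := {τ | ∀ C : GrChart K n s, IsPolyMap K fun f : C.Coord => C.triv f (τ (C.point f))}
  zero_mem' := fun C => by simpa using IsPolyMap.const (K := K) (M := C.Coord) (0 : C.Coord)
  add_mem' := fun hσ hτ C => by simpa using (hσ C).add (hτ C)
  smul_mem' := fun a _ hσ C => by simpa using (hσ C).smul a

/-- `ad Kⁿ`: the vector space of `n × n` matrices of trace zero. -/
abbrev Ad : Submodule K (Matrix (Fin n) (Fin n) K) :=
  LinearMap.ker (Matrix.traceLinearMap (Fin n) K K)

variable {K n s}

/-- The value `V → Kⁿ → Kⁿ → Kⁿ/V` at `V` of the section defined by a matrix `A`. -/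
def matrixSection (A : Matrix (Fin n) (Fin n) K) (V : Gr K n s) : TGrFiber K n s V :=
  V.1.mkQ ∘ₗ A.mulVecLin ∘ₗ V.1.subtype

theorem GrChart.triv_matrixSection (C : GrChart K n s) (A : Matrix (Fin n) (Fin n) K)
    (f : C.Coord) :
    C.triv f (matrixSection A (C.point f)) =
      (C.W.projectionOnto C.V₀.1 C.isCompl.symm ∘ₗ A.mulVecLin) ∘ₗ C.emb f -
        f ∘ₗ ((C.V₀.1.projectionOnto C.W C.isCompl ∘ₗ A.mulVecLin) ∘ₗ C.emb f) := by
  ext1 v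
  set x : Fin n → K := A.mulVecLin (C.emb f v) with hx
  have h1 : C.triv f (matrixSection A (C.point f)) v =
      Submodule.quotientEquivOfIsCompl (C.point f).1 C.W (C.isCompl_point f)
        (Submodule.Quotient.mk x) := rfl
  have h2 : x = (C.V₀.1.projectionOnto C.W C.isCompl x : Fin n → K) +
      (C.W.projectionOnto C.V₀.1 C.isCompl.symm x : Fin n → K) := by
    simpa using (Submodule.projection_add_projection_eq_self C.isCompl x).symm
  rw [h1, ← LinearEquiv.eq_symm_apply, Submodule.quotientEquivOfIsCompl_symm_apply,
    Submodule.Quotient.eq]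
  refine ⟨C.V₀.1.projectionOnto C.W C.isCompl x, ?_⟩
  have h3 : (((C.W.projectionOnto C.V₀.1 C.isCompl.symm ∘ₗ A.mulVecLin) ∘ₗ C.emb f -
        f ∘ₗ ((C.V₀.1.projectionOnto C.W C.isCompl ∘ₗ A.mulVecLin) ∘ₗ C.emb f)) v : Fin n → K) =
      (C.W.projectionOnto C.V₀.1 C.isCompl.symm x : Fin n → K) -
        (f (C.V₀.1.projectionOnto C.W C.isCompl x) : Fin n → K) := rfl
  rw [h3, GrChart.emb_apply]
  nth_rewrite 3 [h2]
  abel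

theorem isPolyMap_matrixSection (A : Matrix (Fin n) (Fin n) K) (C : GrChart K n s) :
    IsPolyMap K fun f : C.Coord => C.triv f (matrixSection A (C.point f)) := by
  simp only [C.triv_matrixSection]
  let P : (Fin n → K) →ₗ[K] C.W := C.W.projectionOnto C.V₀.1 C.isCompl.symm ∘ₗ A.mulVecLin
  let R : (Fin n → K) →ₗ[K] C.V₀.1 := C.V₀.1.projectionOnto C.W C.isCompl ∘ₗ A.mulVecLin
  have hid : IsPolyMap K fun f : C.Coord => f := IsPolyMap.linear LinearMap.id
  have hemb : IsPolyMap K fun f : C.Coord => C.emb f :=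
    IsPolyMap.add (IsPolyMap.const _) (IsPolyMap.comp (IsPolyMap.const _) hid)
  have hP : IsPolyMap K fun f : C.Coord => P ∘ₗ C.emb f :=
    IsPolyMap.comp (IsPolyMap.const _) hemb
  have hR : IsPolyMap K fun f : C.Coord => R ∘ₗ C.emb f :=
    IsPolyMap.comp (IsPolyMap.const _) hemb
  have hfR : IsPolyMap K fun f : C.Coord => f ∘ₗ (R ∘ₗ C.emb f) := IsPolyMap.comp hid hR
  exact hP.sub hfR

variable (K n s)

/-- The natural map `ad Kⁿ → H⁰(TGr(s, Kⁿ))`, `A ↦ s_A`. -/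
def adToH0TGr : Ad K n →ₗ[K] H0TGr K n s where
  toFun A := ⟨fun V => matrixSection A.1 V, isPolyMap_matrixSection A.1⟩
  map_add' A B := by
    ext V v
    simp [matrixSection]
  map_smul' a A := by
    ext V v
    simp [matrixSection]

end Grassmannian

/-! ### The bundle `E = p^*𝒪(1) ⊗ q^*TGr(s, Kⁿ)` and its canonical section -/

section Bundle

variable (K : Type*) [Field K] (n s : ℕ)

/-- The product `X = ℙ(ad Kⁿ) × Gr(s, Kⁿ)`, with its projections `p = Prod.fst`, `q = Prod.snd`. -/
abbrev X : Type _ := ℙ K (Ad K n) × Gr K n s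

/-- The fiber of `E = p^*𝒪(1) ⊗ q^*TGr(s, Kⁿ)` at a point of `X`. -/
abbrev EFiber (x : X K n s) : Type _ := O1Fiber K (Ad K n) x.1 ⊗[K] TGrFiber K n s x.2

variable {K n s}

/-- The trivialization of `E` over a product of charts, the tensor product of the trivializations
of the two factors: `[a + h]* ⊗ Hom(V, Kⁿ/V) ≅ K ⊗ Hom(V₀, W) ≅ Hom(V₀, W)`. -/
def trivE (C : ProjChart K (Ad K n)) (D : GrChart K n s) (y : C.H × D.Coord) :
    EFiber K n s (C.point y.1, D.point y.2) →ₗ[K] D.Coord :=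
  (TensorProduct.lid K D.Coord).toLinearMap ∘ₗ
    TensorProduct.map (C.triv y.1) (D.triv y.2).toLinearMap

variable (K n s)

/-- `H⁰(X, E)`: the global sections of `E` that are regular in every product of charts. -/
def H0E : Submodule K ((x : X K n s) → EFiber K n s x) where
  carrier := {σ | ∀ (C : ProjChart K (Ad K n)) (D : GrChart K n s),
    IsPolyMap K fun y : C.H × D.Coord => trivE C D y (σ (C.point y.1, D.point y.2))}
  zero_mem' := fun C D => by
    simpa using IsPolyMap.const (K := K) (M := C.H × D.Coord) (0 : D.Coord)
  add_mem' := fun hσ hτ C D => by simpa using (hσ C D).add (hτ C D)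
  smul_mem' := fun a _ hσ C D => by simpa using (hσ C D).smul a

variable {K n s} in
theorem isPolyMap_trivE_tmul (σ : H0O1 K (Ad K n)) (τ : H0TGr K n s) (C : ProjChart K (Ad K n))
    (D : GrChart K n s) : IsPolyMap K fun y : C.H × D.Coord =>
      trivE C D y (σ.1 (C.point y.1) ⊗ₜ[K] τ.1 (D.point y.2)) := by
  exact IsPolyMap.fun_smul (IsPolyMap.comp_fst (σ.2 C)) (IsPolyMap.comp_snd (τ.2 D))

variable {K n s} in
/-- The section `p^*σ ⊗ q^*τ` of `E`. -/
def extProd (σ : H0O1 K (Ad K n)) (τ : H0TGr K n s) : H0E K n s :=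
  ⟨fun x => σ.1 x.1 ⊗ₜ[K] τ.1 x.2, isPolyMap_trivE_tmul σ τ⟩

/-- The Künneth map `H⁰(ℙ(ad Kⁿ), 𝒪(1)) ⊗ H⁰(TGr(s, Kⁿ)) → H⁰(X, E)`, sending `σ ⊗ τ` to
`p^*σ ⊗ q^*τ`. -/
def kunneth : H0O1 K (Ad K n) ⊗[K] H0TGr K n s →ₗ[K] H0E K n s :=
  TensorProduct.lift (LinearMap.mk₂ K extProd
    (fun σ σ' τ => Subtype.ext (funext fun x => TensorProduct.add_tmul (σ.1 x.1) (σ'.1 x.1) (τ.1 x.2)))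
    (fun a σ τ => Subtype.ext (funext fun x => (TensorProduct.smul_tmul' a (σ.1 x.1) (τ.1 x.2)).symm))
    (fun σ τ τ' => Subtype.ext (funext fun x => TensorProduct.tmul_add (σ.1 x.1) (τ.1 x.2) (τ'.1 x.2)))
    (fun a σ τ => Subtype.ext (funext fun x => TensorProduct.tmul_smul a (σ.1 x.1) (τ.1 x.2))))

/-- The natural map
`End(ad Kⁿ) ≅ (ad Kⁿ)* ⊗ ad Kⁿ → H⁰(ℙ(ad Kⁿ), 𝒪(1)) ⊗ H⁰(TGr(s, Kⁿ)) → H⁰(X, E)`. -/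
def endToH0E : (Ad K n →ₗ[K] Ad K n) →ₗ[K] H0E K n s :=
  kunneth K n s ∘ₗ
    TensorProduct.map (dualToH0O1 K (Ad K n)) (adToH0TGr K n s) ∘ₗ
      (dualTensorHomEquiv K (Ad K n) (Ad K n)).symm.toLinearMap

/-- The canonical section `c ∈ H⁰(X, E)` determined by the identity map of `ad Kⁿ`. -/
def canonicalSection : H0E K n s := endToH0E K n s LinearMap.id

variable {K n s} in
/-- The zero locus `Z(σ)` of a section of `E`. -/
def zeroLocus (σ : H0E K n s) : Set (X K n s) := {x | σ.1 x = 0}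

/-- The incidence variety `𝒥` of all pairs `(A, V)` in `ℙ(ad Kⁿ) × Gr(s, Kⁿ)` with `A(V) ⊆ V`. A
point of `ℙ(ad Kⁿ)` is a line of matrices, and `A` runs through that line. -/
def incidenceVariety : Set (X K n s) :=
  {x | ∀ A ∈ x.1.submodule, ∀ v ∈ x.2.1, A.1.mulVec v ∈ x.2.1}

end Bundle

end KalmanVariety

end

/-!
The fiber of `E` at `(ℓ, V)` is `ℓ* ⊗ Hom(V, Kⁿ/V)`, and since the line `ℓ` is finite-dimensional
the contraction identifies it with `Hom(ℓ, Hom(V, Kⁿ/V))`: that is, `E` is `Hom(𝒪(-1), TGr)`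
pulled back to the product. Under this identification the section attached to an endomorphism `f`
of `ad Kⁿ` takes the value `A ↦ (V ↪ Kⁿ → Kⁿ → Kⁿ/V)` with middle map `f A`
(`dualTensorHom_endToH0E_apply`); both sides are linear in `f`, so it is enough to compare them on
the tensors `φ ⊗ B`. For `f = id` the section vanishes at `(ℓ, V)` exactly when every `A ∈ ℓ`
induces the zero map `V → Kⁿ/V`, i.e. maps `V` into itself (`matrixSection_eq_zero_iff`).
-/

namespace KalmanVariety

variable {K : Type*} [Field K] {n s : ℕ}

theorem matrixSection_eq_zero_iff (A : Matrix (Fin n) (Fin n) K) (V : Gr K n s) :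
    matrixSection A V = 0 ↔ ∀ v ∈ V.1, A.mulVec v ∈ V.1 := by
  simp [matrixSection, LinearMap.ext_iff]

/-- The value at `(ℓ, V)` of the section attached to `f`, contracted with `A ∈ ℓ`, is the map
`V → Kⁿ/V` induced by the matrix `f A`. -/
theorem dualTensorHom_endToH0E_apply (f : Ad K n →ₗ[K] Ad K n) (x : X K n s)
    (A : x.1.submodule) :
    dualTensorHom K x.1.submodule (TGrFiber K n s x.2) ((endToH0E K n s f).1 x) A =
      matrixSection (f A.1).1 x.2 := by
  obtain ⟨t, rfl⟩ := (dualTensorHomEquiv K (Ad K n) (Ad K n)).surjective f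
  simp only [endToH0E, LinearMap.comp_apply, LinearEquiv.coe_coe, LinearEquiv.symm_apply_apply]
  induction t with
  | zero =>
    simp [matrixSection]
  | add t u ht hu =>
    simp only [map_add, LinearMap.add_apply, Submodule.coe_add, Pi.add_apply, ht, hu]
    ext v
    simp [matrixSection]
  | tmul φ B =>
    have h : (kunneth K n s (TensorProduct.map (dualToH0O1 K (Ad K n)) (adToH0TGr K n s)
        (φ ⊗ₜ[K] B))).1 x = (φ ∘ₗ x.1.submodule.subtype) ⊗ₜ[K] matrixSection B.1 x.2 := rfl
    rw [h, dualTensorHom_apply]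
    ext v
    simp [matrixSection]

end KalmanVariety

theorem proposition5p4 (K : Type*) [Field K] [IsAlgClosed K] [CharZero K] (n s : ℕ) :
    KalmanVariety.zeroLocus (KalmanVariety.canonicalSection K n s) =
      KalmanVariety.incidenceVariety K n s := by
  ext x
  have hproj : Module.Projective K x.1.submodule :=
    Module.Projective.of_basis (Module.Basis.ofVectorSpace K x.1.submodule)
  have hinj : Function.Injective
      (dualTensorHom K x.1.submodule (KalmanVariety.TGrFiber K n s x.2)) :=
    dualTensorHom_bijective.injective
  rw [KalmanVariety.zeroLocus, Set.mem_ofPred_eq, ← map_eq_zero_iff _ hinj, LinearMap.ext_iff]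
  simp only [KalmanVariety.canonicalSection, KalmanVariety.dualTensorHom_endToH0E_apply,
    LinearMap.id_apply, LinearMap.zero_apply, KalmanVariety.matrixSection_eq_zero_iff]
  exact Subtype.forall
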